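/- Let $r,s,t,u$ be integers with $ru-st=\pm1$ and $rstu\neq 0$, and let $G$ be the group (the fundamental group of the torus semi-bundle, or sapphire, $K(r,s,t,u)$) with presentation $$G=\langle a_1,b_1,a_2 \mid a_1b_1a_1^{-1}=b_1^{-1},\ a_2^2=a_1^{2r}b_1^{s},\ a_2a_1^{2t}b_1^{u}a_2^{-1}=b_1^{-u}a_1^{-2t}\rangle .$$ Put $x=a_1^2$, $y=b_1$. For a word $w$ in the generators and a generator $z$, let $\partial w/\partial z\in\mathbb ZG$ be the image of the Fox derivative, i.e. of the map from the free group to its integral group ring determined by $\partial z'/\partial z=\delta_{z',z}$ on generators and $\partial(vw)/\partial z=\partial v/\partial z+v\,\partial w/\partial z$. Let $F_0=F_3=\mathbb ZG$, let $F_1$ be the free left $\mathbb ZG$-module on $\alpha_1,\beta_1,\alpha_2$ and $F_2$ the free left $\mathbb ZG$-module on $\rho_1,\rho_2,\rho_3$. Define left $\mathbb ZG$-linear maps $\varepsilon\colon F_0\to\mathbb Z$ (trivial action on $\mathbb Z$), $d_1\colon F_1\to F_0$, $d_2\colon F_2\to F_1$ by $\varepsilon(1)=1$, $$d_1(\alpha_1)=a_1-1,\quad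 d_1(\beta_1)=b_1-1,\quad d_1(\alpha_2)=a_2-1,$$ $$d_2(\rho_1)=(1-b_1^{-1})\alpha_1+(a_1+b_1^{-1})\beta_1,$$ $$d_2(\rho_2)=\frac{\partial a_1^{2r}}{\partial a_1}\alpha_1+a_1^{2r}\frac{\partial b_1^{s}}{\partial b_1}\beta_1+(-a_2-1)\alpha_2,$$ $$d_2(\rho_3)=\Big(a_2\frac{\partial a_1^{2t}}{\partial a_1}+a_1^{-2t}b_1^{-u}\frac{\partial a_1^{2t}}{\partial a_1}\Big)\alpha_1+\Big(a_2a_1^{2t}\frac{\partial b_1^{u}}{\partial b_1}+b_1^{-u}\frac{\partial b_1^{u}}{\partial b_1}\Big)\beta_1+(1-a_1^{-2t}b_1^{-u})\alpha_2 .$$ Then the coefficients of $d_2(\rho_1),d_2(\rho_2),d_2(\rho_3)$ in $\alpha_1,\beta_1,\alpha_2$ are the Fox derivatives with respect to $a_1,b_1,a_2$ of the relators $a_1b_1a_1^{-1}b_1$, $a_1^{2r}b_1^{s}a_2^{-2}$, $a_2a_1^{2t}b_1^{u}a_2^{-1}a_1^{2t}b_1^{u}$. Moreover, with $Y_0=1-x^ty^u$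 and $Z_0=a_2-x^ty^u$, there is exactly one $X_0\in\mathbb ZG$ such that, for the left $\mathbb ZG$-linear map $d_3\colon F_3\to F_2$ with $d_3(1)=X_0\rho_1+Y_0\rho_2+Z_0\rho_3$, the sequence $$0\to F_3\xrightarrow{d_3}F_2\xrightarrow{d_2}F_1\xrightarrow{d_1}F_0\xrightarrow{\varepsilon}\mathbb Z\to0$$ is exact, i.e. is a free resolution of $\mathbb Z$ over $\mathbb ZG$; and if $r>0$ and $t<0$, then $$X_0=\Big(\sum_{k=t}^{r+t-1}a_1^{2k}\frac{\partial b_1^{u}}{\partial b_1}+\sum_{k=r+t}^{r-1}a_1^{2k}\frac{\partial b_1^{s}}{\partial b_1}+\sum_{k=t+1}^{r+t}a_1^{2k-1}\frac{\partial b_1^{-u}}{\partial b_1}+\sum_{k=r+t+1}^{r}a_1^{2k-1}\frac{\partial b_1^{-s}}{\partial b_1}\Big)b_1 .$$ -/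

import Mathlib

namespace Sapphire

noncomputable section

/-! ### Fox derivatives on a free group -/

/-- The free group `F` on `α` acting on the additive group of `ℤ[F]` by left multiplication. -/
def leftMulAut (α : Type*) :
    FreeGroup α →* MulAut (Multiplicative (MonoidAlgebra ℤ (FreeGroup α))) where
  toFun g :=
    { toFun := fun m => Multiplicative.ofAdd (MonoidAlgebra.of ℤ _ g * m.toAdd)
      invFun := fun m => Multiplicative.ofAdd (MonoidAlgebra.of ℤ _ g⁻¹ * m.toAdd)
      left_inv := fun m => by
        simp only [toAdd_ofAdd, ← mul_assoc, ← map_mul, inv_mul_cancel, map_one, one_mul,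
          ofAdd_toAdd]
      right_inv := fun m => by
        simp only [toAdd_ofAdd, ← mul_assoc, ← map_mul, mul_inv_cancel, map_one, one_mul,
          ofAdd_toAdd]
      map_mul' := fun m n => by
        simp only [toAdd_mul, mul_add, ofAdd_add] }
  map_one' := by
    ext m
    simp only [map_one, one_mul, ofAdd_toAdd, MulEquiv.coe_mk, Equiv.coe_fn_mk, MulAut.one_apply]
  map_mul' g h := by
    ext m
    simp only [map_mul, mul_assoc, MulEquiv.coe_mk, Equiv.coe_fn_mk, MulAut.mul_apply,
      toAdd_ofAdd]

/-- The homomorphism `w ↦ (∂w/∂x_j, w)` from `F` to `ℤ[F] ⋊ F`. -/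
def foxHom {α : Type*} [DecidableEq α] (j : α) :
    FreeGroup α →* Multiplicative (MonoidAlgebra ℤ (FreeGroup α)) ⋊[leftMulAut α] FreeGroup α :=
  FreeGroup.lift fun i => ⟨Multiplicative.ofAdd (if i = j then 1 else 0), FreeGroup.of i⟩

/-- The Fox derivative `∂w/∂x_j ∈ ℤ[F]` of `w ∈ F`: the unique map with
`∂x_i/∂x_j = δ_ij` and `∂(vw)/∂x_j = ∂v/∂x_j + v ∂w/∂x_j`; see `foxDeriv_of`, `foxDeriv_mul`. -/
def foxDeriv {α : Type*} [DecidableEq α] (j : α) (w : FreeGroup α) :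
    MonoidAlgebra ℤ (FreeGroup α) :=
  (foxHom j w).left.toAdd

theorem foxHom_right {α : Type*} [DecidableEq α] (j : α) (w : FreeGroup α) :
    (foxHom j w).right = w := by
  have h : SemidirectProduct.rightHom.comp (foxHom j) = MonoidHom.id (FreeGroup α) := by
    ext i
    simp [foxHom]
  exact DFunLike.congr_fun h w

theorem foxDeriv_of {α : Type*} [DecidableEq α] (j i : α) :
    foxDeriv j (FreeGroup.of i) = if i = j then 1 else 0 := by
  simp [foxDeriv, foxHom]

theorem foxDeriv_mul {α : Type*} [DecidableEq α] (j : α) (v w : FreeGroup α) :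
    foxDeriv j (v * w) = foxDeriv j v + MonoidAlgebra.of ℤ _ v * foxDeriv j w := by
  simp only [foxDeriv, map_mul, SemidirectProduct.mul_left, toAdd_mul, foxHom_right]
  rfl

/-! ### The group `G` of the sapphire `K(r, s, t, u)`

The generators `0, 1, 2` of the free group on `Fin 3` stand for `a₁, b₁, a₂`. -/

/-- The relators `a₁ b₁ a₁⁻¹ b₁`, `a₁^{2r} b₁^s a₂⁻²` and
`a₂ a₁^{2t} b₁^u a₂⁻¹ a₁^{2t} b₁^u`, that is, the relations `a₁ b₁ a₁⁻¹ = b₁⁻¹`,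
`a₂² = a₁^{2r} b₁^s` and `a₂ a₁^{2t} b₁^u a₂⁻¹ = b₁^{-u} a₁^{-2t}`. -/
def relator (r s t u : ℤ) : Fin 3 → FreeGroup (Fin 3) :=
  let a₁ := FreeGroup.of (0 : Fin 3)
  let b₁ := FreeGroup.of (1 : Fin 3)
  let a₂ := FreeGroup.of (2 : Fin 3)
  ![a₁ * b₁ * a₁⁻¹ * b₁,
    a₁ ^ (2 * r) * b₁ ^ s * (a₂ ^ 2)⁻¹,
    a₂ * a₁ ^ (2 * t) * b₁ ^ u * a₂⁻¹ * a₁ ^ (2 * t) * b₁ ^ u]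

/-- The fundamental group of the torus semi-bundle `K(r, s, t, u)`, by its presentation. -/
abbrev G (r s t u : ℤ) : Type :=
  PresentedGroup (Set.range (relator r s t u))

/-- The integral group ring `ℤG`. -/
abbrev ZG (r s t u : ℤ) : Type :=
  MonoidAlgebra ℤ (G r s t u)

/-- The image in `ℤG` of a word in the generators. -/
def word (r s t u : ℤ) (w : FreeGroup (Fin 3)) : ZG r s t u :=
  MonoidAlgebra.of ℤ (G r s t u) (PresentedGroup.mk (Set.range (relator r s t u)) w)

/-- The image in `ℤG` of the Fox derivative `∂w/∂x_j`. -/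
def fox (r s t u : ℤ) (j : Fin 3) (w : FreeGroup (Fin 3)) : ZG r s t u :=
  MonoidAlgebra.mapDomainRingHom ℤ (PresentedGroup.mk (Set.range (relator r s t u)))
    (foxDeriv j w)

/-! ### The complex `0 → ℤG → ℤG³ → ℤG³ → ℤG → ℤ → 0`

The standard bases of `F₁ = ℤG³` and `F₂ = ℤG³` are `(α₁, β₁, α₂)` and `(ρ₁, ρ₂, ρ₃)`. -/

/-- `ℤ` as a `ℤG`-module with trivial action of `G`. -/
abbrev TrivZ (r s t u : ℤ) : Type :=
  (Representation.trivial ℤ (G r s t u) ℤ).asModule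

/-- The augmentation: the `ℤG`-linear map with `ε(1) = 1`. -/
def augmentation (r s t u : ℤ) : ZG r s t u →ₗ[ZG r s t u] TrivZ r s t u :=
  LinearMap.toSpanSingleton (ZG r s t u) (TrivZ r s t u)
    ((Representation.trivial ℤ (G r s t u) ℤ).asModuleEquiv.symm 1)

/-- `d₁(α₁) = a₁ - 1`, `d₁(β₁) = b₁ - 1`, `d₁(α₂) = a₂ - 1`. -/
def d₁ (r s t u : ℤ) : (Fin 3 → ZG r s t u) →ₗ[ZG r s t u] ZG r s t u :=
  Fintype.linearCombination (ZG r s t u)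
    (fun j : Fin 3 => word r s t u (FreeGroup.of j) - 1)

/-- The coefficients of `d₂(ρ₁)`, `d₂(ρ₂)`, `d₂(ρ₃)` in the basis `α₁, β₁, α₂`. -/
def d₂Rows (r s t u : ℤ) : Fin 3 → Fin 3 → ZG r s t u :=
  let a₁ := FreeGroup.of (0 : Fin 3)
  let b₁ := FreeGroup.of (1 : Fin 3)
  let a₂ := FreeGroup.of (2 : Fin 3)
  let w := word r s t u
  let D := fox r s t u
  ![![1 - w b₁⁻¹,
      w a₁ + w b₁⁻¹,
      0],
    ![D 0 (a₁ ^ (2 * r)),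
      w (a₁ ^ (2 * r)) * D 1 (b₁ ^ s),
      -w a₂ - 1],
    ![w a₂ * D 0 (a₁ ^ (2 * t)) + w (a₁ ^ (-(2 * t)) * b₁ ^ (-u)) * D 0 (a₁ ^ (2 * t)),
      w (a₂ * a₁ ^ (2 * t)) * D 1 (b₁ ^ u) + w (b₁ ^ (-u)) * D 1 (b₁ ^ u),
      1 - w (a₁ ^ (-(2 * t)) * b₁ ^ (-u))]]

/-- The map `d₂ : F₂ → F₁`. -/
def d₂ (r s t u : ℤ) : (Fin 3 → ZG r s t u) →ₗ[ZG r s t u] (Fin 3 → ZG r s t u) :=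
  Fintype.linearCombination (ZG r s t u) (d₂Rows r s t u)

/-- `Y₀ = 1 - x^t y^u`, where `x = a₁²` and `y = b₁`. -/
def Y₀ (r s t u : ℤ) : ZG r s t u :=
  let x := FreeGroup.of (0 : Fin 3) ^ 2
  let y := FreeGroup.of (1 : Fin 3)
  1 - word r s t u (x ^ t * y ^ u)

/-- `Z₀ = a₂ - x^t y^u`, where `x = a₁²` and `y = b₁`. -/
def Z₀ (r s t u : ℤ) : ZG r s t u :=
  let x := FreeGroup.of (0 : Fin 3) ^ 2
  let y := FreeGroup.of (1 : Fin 3)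
  let a₂ := FreeGroup.of (2 : Fin 3)
  word r s t u a₂ - word r s t u (x ^ t * y ^ u)

/-- The explicit coefficient `X₀` for `r > 0` and `t < 0`. -/
def X₀ (r s t u : ℤ) : ZG r s t u :=
  let a₁ := FreeGroup.of (0 : Fin 3)
  let b₁ := FreeGroup.of (1 : Fin 3)
  let w := word r s t u
  let D := fox r s t u
  ((∑ k ∈ Finset.Icc t (r + t - 1), w (a₁ ^ (2 * k)) * D 1 (b₁ ^ u)) +
    (∑ k ∈ Finset.Icc (r + t) (r - 1), w (a₁ ^ (2 * k)) * D 1 (b₁ ^ s)) +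
    (∑ k ∈ Finset.Icc (t + 1) (r + t), w (a₁ ^ (2 * k - 1)) * D 1 (b₁ ^ (-u))) +
    (∑ k ∈ Finset.Icc (r + t + 1) r, w (a₁ ^ (2 * k - 1)) * D 1 (b₁ ^ (-s)))) * w b₁

/-- The `ℤG`-linear map `d₃ : F₃ → F₂` with `d₃(1) = X ρ₁ + Y₀ ρ₂ + Z₀ ρ₃`. -/
def d₃ (r s t u : ℤ) (X : ZG r s t u) :
    ZG r s t u →ₗ[ZG r s t u] (Fin 3 → ZG r s t u) :=
  LinearMap.toSpanSingleton (ZG r s t u) (Fin 3 → ZG r s t u)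
    ![X, Y₀ r s t u, Z₀ r s t u]

/-- The sequence `0 → ℤG → ℤG³ → ℤG³ → ℤG → ℤ → 0` with maps `d₃` (for the coefficient `X`),
`d₂`, `d₁`, `ε` is exact; being made of free modules, it is then a free resolution of `ℤ`. -/
def IsResolution (r s t u : ℤ) (X : ZG r s t u) : Prop :=
  Function.Injective (d₃ r s t u X) ∧
  Function.Exact (d₃ r s t u X) (d₂ r s t u) ∧
  Function.Exact (d₂ r s t u) (d₁ r s t u) ∧
  Function.Exact (d₁ r s t u) (augmentation r s t u) ∧
  Function.Surjective (augmentation r s t u)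

end

end Sapphire

/-!
The exactness of the sequence splits into two parts of a different nature.

At `ℤ`, `F₀` and `F₁` nothing about `G` is used except that it is given by a presentation whose Fox
matrix is `d₂`. Words act through `∑ ∂w/∂x_j (x_j - 1) = w - 1` (`sum_fox_mul_sub_one`), so the image
of `d₁` is the augmentation ideal. The vector of Fox derivatives of a word, modulo the image of
`d₂`, depends only on the class of the word in `G` (`fox_sub_fox_mem_range`); its additive extension
to `ℤG` is a left inverse of `d₁` modulo the image of `d₂`, which gives exactness at `F₁`
(`exact_d₂_d₁`).

At `F₂` and `F₃` let `z = xᵗ yᵘ`. The coefficients of `α₂` involve only `z` and `a₂`, which satisfy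
the Klein bottle relation `a₂ z a₂⁻¹ = z⁻¹`, and `Z₀ (1 - z⁻¹) = Y₀ (a₂ + 1)`. If
`p ρ₁ + q ρ₂ + m ρ₃` is a cycle, its `α₂`-coordinate reads `q (a₂ + 1) = m (1 - z⁻¹)`. Modulo the
left ideal `ℤG (1 - z)`, that is in `ℤ[G/⟨z⟩]`, right multiplication by `a₂` permutes the cosets
freely, so a finitely supported solution of `q (a₂ + 1) = 0` is zero (`exists_eq_of_mul_add_one`).
Hence `q = w Y₀`, then `m = w Z₀`, and the `α₁`-coordinate forces `p = w X₀`, because `1 - b₁⁻¹` is not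
a right zero divisor. For the same reason `d₃` is injective and `X₀` is determined by the vanishing
of the `α₁`-coordinate of `d₂(d₃(1))` (`IsCoefficient`). Conversely that equation suffices for
`d₂ ∘ d₃ = 0`, as the `β₁`-coordinate is controlled by `d₁ ∘ d₂ = 0`. It is solved explicitly in the
group ring of the Klein bottle group generated by `a₁` and `b₁` (`klein_quotient`), for all signs of
`r` and `t`; for `r > 0` and `t < 0` the geometric sums in the solution unfold to the stated formula.

The only facts about `G` used here are that `b₁` and `z` have infinite order and that no nontrivial
power of `a₂` lies in `⟨z⟩`. They are read off from a homomorphism of `G` to an amalgam of two Klein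
bottle groups along `ℤ²`, whose factors embed (`exists_hom_amalgam`).
-/

namespace Sapphire

open MonoidAlgebra

/-! ### One-sided divisibility in integral group rings -/

section GroupRing

variable {H : Type*} [Group H]

theorem of_mul_of (g h : H) : of ℤ H g * of ℤ H h = of ℤ H (g * h) :=
  (map_mul _ _ _).symm

/-- A finitely supported function that changes only by a sign along an injective self-map without
periodic points vanishes, because its support would contain an infinite orbit. -/
theorem finsupp_eq_zero_of_mapDomain_eq {C : Type*} {R : C → C} (hR : Function.Injective R)
    (hfree : ∀ c, Function.Injective fun n : ℕ => R^[n] c) {f : C →₀ ℤ}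
    (hf : f.mapDomain R = f ∨ f.mapDomain R = -f) : f = 0 := by
  have habs : ∀ c, |f (R c)| = |f c| := by
    intro c
    have h := Finsupp.mapDomain_apply hR f c
    rcases hf with hf | hf <;> rw [hf] at h
    · rw [h]
    · rw [← h, Finsupp.neg_apply, abs_neg]
  ext c
  by_contra hc
  have hmem : ∀ n : ℕ, R^[n] c ∈ f.support := by
    intro n
    rw [Finsupp.mem_support_iff, ← abs_ne_zero]
    induction n with
    | zero => simpa using hc
    | succ n ih => rwa [Function.iterate_succ_apply', habs]
  exact Set.infinite_of_injective_forall_mem (hfree c) hmem f.support.finite_toSet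

theorem mul_of_eq_mapDomain (f : MonoidAlgebra ℤ H) (g : H) :
    (f * of ℤ H g).coeff = f.coeff.mapDomain (· * g) := by
  induction f using MonoidAlgebra.induction_linear with
  | zero => simp
  | add f₁ f₂ h₁ h₂ => rw [add_mul, coeff_add, h₁, h₂, coeff_add, Finsupp.mapDomain_add]
  | single h n => simp [single_mul_single, Finsupp.mapDomain_single]

/-- Right multiplication by `1 - g` is injective if `g` has infinite order. -/
theorem eq_zero_of_mul_one_sub_of {g : H} (hg : ∀ k : ℤ, g ^ k = 1 → k = 0)
    {f : MonoidAlgebra ℤ H} (hf : f * (1 - of ℤ H g) = 0) : f = 0 := by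
  rw [mul_sub, mul_one, sub_eq_zero] at hf
  rw [← coeff_eq_zero]
  refine finsupp_eq_zero_of_mapDomain_eq (mul_left_injective g) (fun c m n hmn => ?_)
    (Or.inl (by rw [← mul_of_eq_mapDomain, ← hf]))
  simp only [mul_right_iterate_apply, mul_right_inj] at hmn
  have := hg (m - n) (by rw [zpow_sub, zpow_natCast, zpow_natCast, hmn, mul_inv_cancel])
  omega

/-- An element of `ℤH` whose coefficients sum to zero on each coset `h⟨z⟩` is a left multiple of
`1 - z`. -/
theorem exists_eq_mul_one_sub_of {z : H} {f : MonoidAlgebra ℤ H}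
    (hf : f.coeff.mapDomain (QuotientGroup.mk (s := Subgroup.zpowers z)) = 0) :
    ∃ w, f = w * (1 - of ℤ H z) := by
  let I : Submodule (MonoidAlgebra ℤ H) (MonoidAlgebra ℤ H) := Submodule.span _ {1 - of ℤ H z}
  have hz : ∀ k : ℤ, of ℤ H (z ^ k) - 1 ∈ I := by
    intro k
    have h1 : 1 - of ℤ H z ∈ I := Submodule.mem_span_singleton_self _
    induction k with
    | zero => rw [zpow_zero, map_one, sub_self]; exact I.zero_mem
    | succ k ih =>
      have := I.sub_mem ih (I.smul_mem (of ℤ H (z ^ (k : ℤ))) h1)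
      rw [smul_eq_mul, mul_sub, mul_one, of_mul_of, ← zpow_add_one] at this
      convert this using 1
      abel
    | pred k ih =>
      have := I.add_mem ih (I.smul_mem (of ℤ H (z ^ (-(k : ℤ) - 1))) h1)
      rw [smul_eq_mul, mul_sub, mul_one, of_mul_of, ← zpow_add_one, sub_add_cancel] at this
      convert this using 1
      abel
  have hout : ∀ g : MonoidAlgebra ℤ H, g - ofCoeff ((g.coeff.mapDomain
      (QuotientGroup.mk (s := Subgroup.zpowers z))).mapDomain Quotient.out) ∈ I := by
    intro g
    induction g using MonoidAlgebra.induction_linear with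
    | zero => simp
    | add g₁ g₂ h₁ h₂ =>
      rw [coeff_add, Finsupp.mapDomain_add, Finsupp.mapDomain_add, ofCoeff_add,
        add_sub_add_comm]
      exact I.add_mem h₁ h₂
    | single h n =>
      obtain ⟨⟨_, k, rfl⟩, hk⟩ := QuotientGroup.mk_out_eq_mul (Subgroup.zpowers z) h
      simp only [coeff_single, Finsupp.mapDomain_single, ofCoeff_single, hk]
      have := I.neg_mem (I.smul_mem (single h n) (hz k))
      simpa [smul_eq_mul, mul_sub, single_mul_single] using this
  have := hout f
  rw [hf, Finsupp.mapDomain_zero, ofCoeff_zero, sub_zero, Submodule.mem_span_singleton] at this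
  obtain ⟨w, hw⟩ := this
  exact ⟨w, hw.symm⟩

theorem mapDomain_mk_mul_one_sub_of (z : H) (f : MonoidAlgebra ℤ H) :
    (f * (1 - of ℤ H z)).coeff.mapDomain (QuotientGroup.mk (s := Subgroup.zpowers z)) = 0 := by
  have : (QuotientGroup.mk (s := Subgroup.zpowers z)) ∘ (· * z) = QuotientGroup.mk := by
    ext h
    exact QuotientGroup.mk_mul_of_mem h (Subgroup.mem_zpowers z)
  rw [mul_sub, mul_one, sub_eq_add_neg, coeff_add, Finsupp.mapDomain_add, coeff_neg,
    mul_of_eq_mapDomain]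
  rw [show -Finsupp.mapDomain (· * z) f.coeff = Finsupp.mapDomain (· * z) (-f.coeff) from
    (map_neg (Finsupp.mapDomain.addMonoidHom (· * z)) f.coeff).symm, ← Finsupp.mapDomain_comp, this,
    ← Finsupp.mapDomain_add, add_neg_cancel, Finsupp.mapDomain_zero]

/-- Modulo the left ideal `ℤH(1 - z)`, right multiplication by `c + 1` is injective when `c`
inverts `z` and has infinite order modulo `⟨z⟩`: it permutes the cosets of `⟨z⟩` freely. -/
theorem exists_eq_of_mul_add_one {z c : H} (hcz : c * z * c⁻¹ = z⁻¹)
    (hc : ∀ k : ℤ, c ^ k ∈ Subgroup.zpowers z → k = 0) {q m : MonoidAlgebra ℤ H}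
    (h : q * (of ℤ H c + 1) = m * (1 - of ℤ H z)) : ∃ w, q = w * (1 - of ℤ H z) := by
  apply exists_eq_mul_one_sub_of
  have hconj : ∀ k : ℤ, c⁻¹ * z ^ k * c = z ^ (-k) := by
    intro k
    have h1 : c⁻¹ * z * c = z⁻¹ := by
      rw [← inv_inj, inv_inv, ← mul_right_inj c, ← mul_left_inj c⁻¹]
      simpa [mul_assoc] using hcz.symm
    calc c⁻¹ * z ^ k * c = (c⁻¹ * z * c) ^ k := by
          simpa using (conj_zpow (a := c⁻¹) (b := z) (i := k)).symm
      _ = z ^ (-k) := by rw [h1, inv_zpow, zpow_neg]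
  let R : H ⧸ Subgroup.zpowers z → H ⧸ Subgroup.zpowers z :=
    Quotient.map' (· * c) (by
      intro x y hxy
      rw [QuotientGroup.leftRel_apply] at hxy ⊢
      obtain ⟨k, hk⟩ := hxy
      exact ⟨-k, by
        change z ^ (-k) = _
        rw [← hconj, show z ^ k = x⁻¹ * y from hk]
        group⟩)
  have hRmk : ∀ h : H, R (QuotientGroup.mk h) = QuotientGroup.mk (h * c) := fun _ => rfl
  have hRit : ∀ (n : ℕ) (h : H), R^[n] (QuotientGroup.mk h) = QuotientGroup.mk (h * c ^ n) := by
    intro n h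
    induction n with
    | zero => simp
    | succ n ih => rw [Function.iterate_succ_apply', ih, hRmk, pow_succ, mul_assoc]
  refine finsupp_eq_zero_of_mapDomain_eq (R := R) ?_ ?_ (Or.inr ?_)
  · rintro ⟨x⟩ ⟨y⟩ hxy
    have h1 : (QuotientGroup.mk (x * c) : H ⧸ Subgroup.zpowers z) = QuotientGroup.mk (y * c) := hxy
    rw [QuotientGroup.eq] at h1
    obtain ⟨k, hk⟩ := h1
    refine QuotientGroup.eq.2 ⟨-k, ?_⟩
    have hk' : z ^ k = (x * c)⁻¹ * (y * c) := hk
    change z ^ (-k) = _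
    have h2 := hconj (-k)
    rw [neg_neg, hk', mul_inv_rev, mul_assoc, mul_assoc, mul_right_inj] at h2
    rw [← mul_left_inj c, h2]
    group
  · rintro ⟨x⟩ m n hmn
    have h1 : (QuotientGroup.mk (x * c ^ m) : H ⧸ Subgroup.zpowers z) =
        QuotientGroup.mk (x * c ^ n) := by
      rw [← hRit, ← hRit]
      exact hmn
    rw [QuotientGroup.eq] at h1
    have := hc (n - m) (by
      convert h1 using 1
      rw [zpow_sub, zpow_natCast, zpow_natCast]
      group)
    omega
  · have h1 := mapDomain_mk_mul_one_sub_of z m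
    rw [← h, mul_add, mul_one, coeff_add, Finsupp.mapDomain_add, mul_of_eq_mapDomain,
      ← Finsupp.mapDomain_comp] at h1
    rw [← Finsupp.mapDomain_comp, eq_neg_iff_add_eq_zero, ← h1]
    rfl

end GroupRing

/-! ### Geometric sums -/

section GeomSum

variable {H : Type*} [Group H]

/-- The quotient `(g ^ n - 1) / (g - 1)` in `ℤH`, for an integer `n` of either sign. -/
noncomputable def geomSum (g : H) (n : ℤ) : MonoidAlgebra ℤ H :=
  ∑ k ∈ Finset.Ico 0 n, of ℤ H (g ^ k) - ∑ k ∈ Finset.Ico n 0, of ℤ H (g ^ k)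

theorem geomSum_zero (g : H) : geomSum g 0 = 0 := by simp [geomSum]

theorem geomSum_add_one (g : H) (n : ℤ) : geomSum g (n + 1) = geomSum g n + of ℤ H (g ^ n) := by
  unfold geomSum
  rcases le_or_gt 0 n with hn | hn
  · rw [← Finset.insert_Ico_right_eq_Ico_add_one hn, Finset.sum_insert (by simp),
      Finset.Ico_eq_empty_of_le hn, Finset.Ico_eq_empty_of_le (by omega : (0 : ℤ) ≤ n + 1)]
    simp [add_comm]
  · rw [← Finset.insert_Ico_add_one_left_eq_Ico hn, Finset.sum_insert (by simp),
      Finset.Ico_eq_empty_of_le hn.le, Finset.Ico_eq_empty_of_le (by omega : n + 1 ≤ 0)]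
    simp

/-- A map on `ℤ` satisfying the recursion of a derivation on powers of `g` is a geometric sum. -/
theorem eq_geomSum_mul {g : H} {D : MonoidAlgebra ℤ H} {f : ℤ → MonoidAlgebra ℤ H} (h0 : f 0 = 0)
    (h1 : ∀ n, f (n + 1) = f n + of ℤ H (g ^ n) * D) (n : ℤ) : f n = geomSum g n * D := by
  induction n with
  | zero => rw [h0, geomSum_zero, zero_mul]
  | succ n ih => rw [h1, ih, geomSum_add_one, add_mul]
  | pred n ih =>
    have h2 := h1 (-(n : ℤ) - 1)
    have h3 := geomSum_add_one g (-(n : ℤ) - 1)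
    rw [sub_add_cancel] at h2 h3
    rw [h3, h2, add_mul] at ih
    exact add_right_cancel ih

theorem geomSum_mul_sub_one (g : H) (n : ℤ) :
    geomSum g n * (of ℤ H g - 1) = of ℤ H (g ^ n) - 1 := by
  rw [← eq_geomSum_mul (f := fun n => of ℤ H (g ^ n) - 1)
    (by rw [zpow_zero, map_one, sub_self]) (fun n => ?_)]
  rw [mul_sub, of_mul_of, zpow_add_one]
  noncomm_ring

theorem geomSum_commute {g h : H} (hgh : Commute g h) (n : ℤ) :
    Commute (geomSum g n) (of ℤ H h) :=
  (Commute.sum_left _ _ _ fun _ _ => (hgh.zpow_left _).map _).sub_left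
    (Commute.sum_left _ _ _ fun _ _ => (hgh.zpow_left _).map _)

theorem of_zpow_mul_geomSum (g : H) (m n : ℤ) : of ℤ H (g ^ m) * geomSum g n =
    ∑ k ∈ Finset.Ico m (m + n), of ℤ H (g ^ k) - ∑ k ∈ Finset.Ico (m + n) m, of ℤ H (g ^ k) := by
  have hmap : ∀ a b : ℤ, of ℤ H (g ^ m) * ∑ k ∈ Finset.Ico a b, of ℤ H (g ^ k) =
      ∑ k ∈ Finset.Ico (m + a) (m + b), of ℤ H (g ^ k) := by
    intro a b
    rw [← Finset.map_add_left_Ico, Finset.sum_map, Finset.mul_sum]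
    simp only [of_mul_of, ← zpow_add, addLeftEmbedding_apply]
  rw [geomSum, mul_sub, hmap, hmap, add_zero]

end GeomSum

/-! ### Fox calculus over `ℤG` -/

section Fox

variable {r s t u : ℤ}

theorem word_mul (v w : FreeGroup (Fin 3)) :
    word r s t u (v * w) = word r s t u v * word r s t u w := by
  simp only [word, map_mul]

theorem word_one : word r s t u 1 = 1 := by
  simp only [word, map_one]

theorem fox_of (j i : Fin 3) : fox r s t u j (FreeGroup.of i) = if i = j then 1 else 0 := by
  rw [fox, foxDeriv_of]
  split_ifs <;> simp only [map_one, map_zero]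

theorem fox_mul (j : Fin 3) (v w : FreeGroup (Fin 3)) :
    fox r s t u j (v * w) = fox r s t u j v + word r s t u v * fox r s t u j w := by
  rw [fox, foxDeriv_mul, map_add, map_mul]
  congr 2
  simp [word]

theorem fox_one (j : Fin 3) : fox r s t u j 1 = 0 := by
  have h := fox_mul (r := r) (s := s) (t := t) (u := u) j 1 1
  rwa [mul_one, word_one, one_mul, left_eq_add] at h

theorem fox_inv (j : Fin 3) (w : FreeGroup (Fin 3)) :
    fox r s t u j w⁻¹ = -(word r s t u w⁻¹ * fox r s t u j w) := by
  have h := fox_mul (r := r) (s := s) (t := t) (u := u) j w⁻¹ w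
  rw [inv_mul_cancel, fox_one] at h
  exact eq_neg_of_add_eq_zero_left h.symm

theorem fox_zpow (j : Fin 3) (w : FreeGroup (Fin 3)) (n : ℤ) : fox r s t u j (w ^ n) =
    geomSum (PresentedGroup.mk (Set.range (relator r s t u)) w) n * fox r s t u j w := by
  refine eq_geomSum_mul (f := fun n => fox r s t u j (w ^ n)) ?_ (fun n => ?_) n
  · rw [zpow_zero, fox_one]
  · rw [zpow_add_one, fox_mul, word, map_zpow]

/-- The fundamental formula of Fox calculus. -/
theorem sum_fox_mul_sub_one (w : FreeGroup (Fin 3)) :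
    ∑ j, fox r s t u j w * (word r s t u (FreeGroup.of j) - 1) = word r s t u w - 1 := by
  have hmul : ∀ v w : FreeGroup (Fin 3),
      ∑ j, fox r s t u j v * (word r s t u (FreeGroup.of j) - 1) = word r s t u v - 1 →
      ∑ j, fox r s t u j w * (word r s t u (FreeGroup.of j) - 1) = word r s t u w - 1 →
      ∑ j, fox r s t u j (v * w) * (word r s t u (FreeGroup.of j) - 1) =
        word r s t u (v * w) - 1 := by
    intro v w hv hw
    simp only [fox_mul, add_mul, mul_assoc, Finset.sum_add_distrib, ← Finset.mul_sum, hv, hw,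
      word_mul]
    noncomm_ring
  induction w using FreeGroup.induction_on with
  | C1 => simp [fox_one, word_one]
  | of i => simp [fox_of]
  | inv_of i h =>
    simp only [fox_inv, neg_mul, mul_assoc, Finset.sum_neg_distrib, ← Finset.mul_sum]
    simp only [h]
    rw [mul_sub, ← word_mul, inv_mul_cancel, word_one, mul_one, neg_sub]
  | mul v w hv hw => exact hmul v w hv hw

theorem word_relator (i : Fin 3) : word r s t u (relator r s t u i) = 1 := by
  rw [word, PresentedGroup.one_of_mem (Set.mem_range_self i), map_one]

theorem d₁_apply (v : Fin 3 → ZG r s t u) :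
    d₁ r s t u v = ∑ j, v j * (word r s t u (FreeGroup.of j) - 1) := by
  simp [d₁, Fintype.linearCombination_apply]

theorem d₂_apply (v : Fin 3 → ZG r s t u) (j : Fin 3) :
    d₂ r s t u v j = ∑ i, v i * d₂Rows r s t u i j := by
  simp [d₂, Fintype.linearCombination_apply, Finset.sum_apply]

end Fox

/-! ### Exactness at `F₁` and `F₀` for a presentation -/

section Presentation

variable {r s t u : ℤ}

theorem d₁_comp_d₂ (hrows : ∀ i j, d₂Rows r s t u i j = fox r s t u j (relator r s t u i))
    (v : Fin 3 → ZG r s t u) : d₁ r s t u (d₂ r s t u v) = 0 := by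
  simp only [d₁_apply, d₂_apply, Finset.sum_mul, mul_assoc]
  rw [Finset.sum_comm]
  refine Finset.sum_eq_zero fun i _ => ?_
  rw [← Finset.mul_sum]
  simp only [hrows]
  rw [sum_fox_mul_sub_one, word_relator, sub_self, mul_zero]

/-- The vector of Fox derivatives of a word, modulo the image of `d₂`, depends only on the element
of `G` that the word represents. -/
theorem fox_sub_fox_mem_range
    (hrows : ∀ i j, d₂Rows r s t u i j = fox r s t u j (relator r s t u i))
    {v w : FreeGroup (Fin 3)} (h : PresentedGroup.mk (Set.range (relator r s t u)) v =
      PresentedGroup.mk (Set.range (relator r s t u)) w) :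
    (fun j => fox r s t u j v) - (fun j => fox r s t u j w) ∈ LinearMap.range (d₂ r s t u) := by
  have hword : word r s t u v = word r s t u w := by rw [word, word, h]
  have hker : ∀ n ∈ Subgroup.normalClosure (Set.range (relator r s t u)),
      (fun j => fox r s t u j n) ∈ LinearMap.range (d₂ r s t u) := by
    intro n hn
    have hone : ∀ {n}, n ∈ Subgroup.normalClosure (Set.range (relator r s t u)) →
        word r s t u n = 1 := fun {n} hn => by
      rw [word, PresentedGroup.mk_eq_one_iff.2 hn, map_one]
    induction hn using Subgroup.closure_induction with
    | mem x hx =>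
      obtain ⟨_, ⟨i, rfl⟩, hx⟩ := Group.mem_conjugatesOfSet_iff.1 hx
      obtain ⟨g, rfl⟩ := isConj_iff.1 hx
      refine ⟨Pi.single i (word r s t u g), funext fun j => ?_⟩
      have hg : word r s t u g * word r s t u g⁻¹ = 1 := by
        rw [← word_mul, mul_inv_cancel, word_one]
      rw [d₂_apply, Finset.sum_eq_single i (fun k _ hk => by simp [hk]) (by simp),
        Pi.single_eq_same, hrows, fox_mul, fox_mul, fox_inv, word_mul, word_relator, mul_one,
        mul_neg, ← mul_assoc, hg]
      noncomm_ring
    | one =>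
      convert Submodule.zero_mem _ using 1
      exact funext fun j => fox_one j
    | mul x y hx hy ihx ihy =>
      convert Submodule.add_mem _ ihx ihy using 1
      refine funext fun j => ?_
      rw [fox_mul, hone hx, one_mul]
      rfl
    | inv x hx ih =>
      convert Submodule.neg_mem _ ih using 1
      refine funext fun j => ?_
      rw [fox_inv, hone (inv_mem hx), one_mul]
      rfl
  have hmem : v⁻¹ * w ∈ Subgroup.normalClosure (Set.range (relator r s t u)) := by
    rw [← PresentedGroup.mk_eq_one_iff, map_mul, map_inv, h, inv_mul_cancel]
  convert Submodule.neg_mem _ (Submodule.smul_mem _ (word r s t u v) (hker _ hmem)) using 1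
  refine funext fun j => ?_
  have hv : word r s t u v * word r s t u v⁻¹ = 1 := by
    rw [← word_mul, mul_inv_cancel, word_one]
  simp only [Pi.sub_apply, Pi.neg_apply, Pi.smul_apply, smul_eq_mul, fox_mul, fox_inv]
  rw [mul_add, mul_neg, ← mul_assoc, ← mul_assoc, hv]
  noncomm_ring

/-- The Fox derivatives induce an additive map `ℤG → F₁ / d₂(F₂)` that sends `d₁(v)` to the class
of `v`; hence the kernel of `d₁` is the image of `d₂`. -/
theorem exact_d₂_d₁ (hrows : ∀ i j, d₂Rows r s t u i j = fox r s t u j (relator r s t u i)) :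
    Function.Exact (d₂ r s t u) (d₁ r s t u) := by
  intro v
  refine ⟨fun hv => ?_, fun ⟨w, hw⟩ => hw ▸ d₁_comp_d₂ hrows w⟩
  let π := (LinearMap.range (d₂ r s t u)).mkQ
  have hsurj := PresentedGroup.mk_surjective (Set.range (relator r s t u))
  let sec := Function.surjInv hsurj
  let D : ZG r s t u →+ (Fin 3 → ZG r s t u) ⧸ LinearMap.range (d₂ r s t u) :=
    (Finsupp.liftAddHom fun g => (zmultiplesHom _) (π fun j => fox r s t u j (sec g))).comp
      coeffAddEquiv.toAddMonoidHom
  have hD : ∀ w, D (word r s t u w) = π fun j => fox r s t u j w := by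
    intro w
    have : D (word r s t u w) = π fun j => fox r s t u j (sec (PresentedGroup.mk _ w)) := by
      simp [D, word, of_apply]
    rw [this, ← sub_eq_zero, ← map_sub, Submodule.mkQ_apply, Submodule.Quotient.mk_eq_zero]
    exact fox_sub_fox_mem_range hrows (Function.surjInv_eq hsurj _)
  have hDmul : ∀ (i : Fin 3) (c : ZG r s t u),
      D (c * (word r s t u (FreeGroup.of i) - 1)) = π (Pi.single i c) := by
    intro i c
    induction c using MonoidAlgebra.induction_linear with
    | zero => simp
    | add c₁ c₂ h₁ h₂ => rw [add_mul, map_add, h₁, h₂, Pi.single_add, map_add]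
    | single g n =>
      obtain ⟨w, rfl⟩ := hsurj g
      have hs : (single (PresentedGroup.mk _ w) n : ZG r s t u) = n • word r s t u w := by
        simp [word]
      rw [hs, smul_mul_assoc, map_zsmul, mul_sub, mul_one, ← word_mul, map_sub, hD, hD, ← map_sub,
        ← map_zsmul]
      congr 1
      funext j
      by_cases hj : i = j
      · subst hj
        simp [fox_mul, fox_of]
      · simp [fox_mul, fox_of, hj, Ne.symm hj]
  have hπ : D (d₁ r s t u v) = π v := by
    rw [d₁_apply, map_sum]
    simp only [hDmul]
    rw [← map_sum, Finset.univ_sum_single]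
  rw [hv, map_zero, Submodule.mkQ_apply, eq_comm, Submodule.Quotient.mk_eq_zero] at hπ
  exact hπ

theorem sub_one_mem_range_d₁ (w : FreeGroup (Fin 3)) :
    word r s t u w - 1 ∈ LinearMap.range (d₁ r s t u) :=
  ⟨fun j => fox r s t u j w, by rw [d₁_apply, sum_fox_mul_sub_one]⟩

theorem augmentation_word (w : FreeGroup (Fin 3)) :
    augmentation r s t u (word r s t u w) = augmentation r s t u 1 := by
  simp [augmentation, word]
  rfl

theorem augmentation_zsmul_one (n : ℤ) : augmentation r s t u (n • 1) =
    (Representation.trivial ℤ (G r s t u) ℤ).asModuleEquiv.symm n := by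
  rw [map_zsmul, augmentation, LinearMap.toSpanSingleton_apply, one_smul, ← map_zsmul]
  simp

theorem exact_d₁_augmentation : Function.Exact (d₁ r s t u) (augmentation r s t u) := by
  have hmod : ∀ c : ZG r s t u, ∃ n : ℤ, c - n • 1 ∈ LinearMap.range (d₁ r s t u) := by
    intro c
    induction c using MonoidAlgebra.induction_linear with
    | zero => exact ⟨0, by simp⟩
    | add c₁ c₂ h₁ h₂ =>
      obtain ⟨n₁, h₁⟩ := h₁
      obtain ⟨n₂, h₂⟩ := h₂
      refine ⟨n₁ + n₂, ?_⟩
      rw [add_smul, add_sub_add_comm]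
      exact Submodule.add_mem _ h₁ h₂
    | single g n =>
      obtain ⟨w, rfl⟩ := PresentedGroup.mk_surjective (Set.range (relator r s t u)) g
      refine ⟨n, ?_⟩
      have hs : (single (PresentedGroup.mk _ w) n : ZG r s t u) = n • word r s t u w := by
        simp [word]
      rw [hs, ← smul_sub]
      exact zsmul_mem (sub_one_mem_range_d₁ w) n
  have haug : ∀ v, augmentation r s t u (d₁ r s t u v) = 0 := by
    intro v
    rw [d₁_apply, map_sum]
    refine Finset.sum_eq_zero fun j _ => ?_
    rw [← smul_eq_mul, map_smul, map_sub, augmentation_word, sub_self, smul_zero]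
  intro c
  refine ⟨fun hc => ?_, fun ⟨v, hv⟩ => hv ▸ haug v⟩
  obtain ⟨n, v, hv⟩ := hmod c
  have h := haug v
  rw [hv, map_sub, hc, zero_sub, neg_eq_zero, augmentation_zsmul_one,
    LinearEquiv.map_eq_zero_iff] at h
  rw [h, zero_smul, sub_zero] at hv
  exact ⟨v, hv⟩

theorem augmentation_surjective : Function.Surjective (augmentation r s t u) := fun n =>
  ⟨(Representation.trivial ℤ (G r s t u) ℤ).asModuleEquiv n • 1, by
    rw [augmentation_zsmul_one, LinearEquiv.symm_apply_apply]⟩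

end Presentation

/-! ### An amalgam of two Klein bottle groups -/

section Amalgam

theorem dihedral_r_one_zpow_eq_one {k : ℤ} (h : (DihedralGroup.r 1 : DihedralGroup 0) ^ k = 1) :
    k = 0 := by
  rwa [← orderOf_dvd_iff_zpow_eq_one, DihedralGroup.orderOf_r_one, Nat.cast_zero,
    zero_dvd_iff] at h

/-- A group containing the Klein bottle group: `kleinA` and `kleinB` generate a copy of
`⟨a, b | a b a⁻¹ = b⁻¹⟩`. -/
abbrev Klein : Type := Multiplicative ℤ × DihedralGroup 0

/-- The generator `a` of the Klein bottle group, acting as translation times reflection. -/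
def kleinA : Klein := (Multiplicative.ofAdd 1, DihedralGroup.sr 0)

/-- The generator `b` of the Klein bottle group, which `kleinA` inverts. -/
def kleinB : Klein := (1, DihedralGroup.r 1)

theorem kleinA_conj_kleinB : kleinA * kleinB * kleinA⁻¹ = kleinB⁻¹ := by
  ext
  · simp [kleinA, kleinB]
  · simp [kleinA, kleinB]

/-- The homomorphism from `ℤ²` to the Klein bottle group, with `a = kleinA` and `b = kleinB`, that
sends `(1, 0)` to `a ^ (2 * p₁) * b ^ p₂` and `(0, 1)` to `a ^ (2 * q₁) * b ^ q₂`. -/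
def torusHom (p₁ p₂ q₁ q₂ : ℤ) : Multiplicative (ℤ × ℤ) →* Klein where
  toFun v := (Multiplicative.ofAdd (2 * (p₁ * v.toAdd.1 + q₁ * v.toAdd.2)),
    DihedralGroup.r 1 ^ (p₂ * v.toAdd.1 + q₂ * v.toAdd.2))
  map_one' := by ext <;> simp
  map_mul' v w := by
    ext
    · simp
      ring
    · simp only [toAdd_mul, Prod.fst_add, Prod.snd_add, Prod.mk_mul_mk, ← zpow_add]
      congr 1
      ring

theorem torusHom_injective {p₁ p₂ q₁ q₂ : ℤ} (h : p₁ * q₂ - p₂ * q₁ ≠ 0) :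
    Function.Injective (torusHom p₁ p₂ q₁ q₂) := by
  rw [injective_iff_map_eq_one]
  intro v hv
  have h1 : 2 * (p₁ * v.toAdd.1 + q₁ * v.toAdd.2) = 0 := congrArg Prod.fst hv
  have h2 : p₂ * v.toAdd.1 + q₂ * v.toAdd.2 = 0 :=
    dihedral_r_one_zpow_eq_one (congrArg Prod.snd hv)
  have h1 : p₁ * v.toAdd.1 + q₁ * v.toAdd.2 = 0 := by omega
  have h3 : v.toAdd.1 = 0 := (mul_eq_zero.1 (by linear_combination q₂ * h1 - q₁ * h2 :
    (p₁ * q₂ - p₂ * q₁) * v.toAdd.1 = 0)).resolve_left h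
  have h4 : v.toAdd.2 = 0 := (mul_eq_zero.1 (by linear_combination p₁ * h2 - p₂ * h1 :
    (p₁ * q₂ - p₂ * q₁) * v.toAdd.2 = 0)).resolve_left h
  exact Multiplicative.toAdd.injective (Prod.ext h3 h4)

theorem kleinA_sq : kleinA ^ (2 : ℤ) = (Multiplicative.ofAdd 2, 1) := by
  rw [zpow_two]
  ext <;> simp [kleinA]

theorem kleinA_zpow_mul_kleinB_zpow (i j : ℤ) : kleinA ^ (2 * i) * kleinB ^ j =
    (Multiplicative.ofAdd (2 * i), DihedralGroup.r 1 ^ j) := by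
  rw [zpow_mul, kleinA_sq]
  ext
  · simp [kleinB, ← ofAdd_zsmul, mul_comm]
  · simp [kleinB]

theorem kleinB_zpow_eq_one {k : ℤ} (h : kleinB ^ k = 1) : k = 0 :=
  dihedral_r_one_zpow_eq_one (congrArg Prod.snd h)

theorem eq_zero_of_kleinA_zpow_eq {k l : ℤ} (h : kleinA ^ k = kleinB ^ l) : k = 0 := by
  have h1 := congrArg Prod.fst h
  simpa [kleinA, kleinB, ← ofAdd_zsmul] using h1

end Amalgam

/-! ### The torus subgroup of `G` -/

section Group

variable (r s t u : ℤ)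

/-- The generator `a₁` of `G`. -/
abbrev genA : G r s t u := PresentedGroup.of 0

/-- The generator `b₁` of `G`. -/
abbrev genB : G r s t u := PresentedGroup.of 1

/-- The generator `a₂` of `G`. -/
abbrev genC : G r s t u := PresentedGroup.of 2

/-- The element `x ^ t * y ^ u` of `G`, which conjugation by `a₂` inverts. -/
abbrev genZ : G r s t u := (genA r s t u ^ (2 : ℤ)) ^ t * genB r s t u ^ u

theorem genA_conj_genB : genA r s t u * genB r s t u * (genA r s t u)⁻¹ = (genB r s t u)⁻¹ :=
  eq_inv_of_mul_eq_one_left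
    (PresentedGroup.one_of_mem (Set.mem_range_self (f := relator r s t u) 0))

theorem genC_sq :
    genC r s t u ^ 2 = (genA r s t u ^ (2 : ℤ)) ^ r * genB r s t u ^ s := by
  rw [← zpow_mul]
  exact (mul_inv_eq_one.1
    (PresentedGroup.one_of_mem (Set.mem_range_self (f := relator r s t u) 1))).symm

theorem genC_conj_genZ :
    genC r s t u * genZ r s t u * (genC r s t u)⁻¹ = (genZ r s t u)⁻¹ := by
  have h : PresentedGroup.mk (Set.range (relator r s t u)) (relator r s t u 2) = 1 :=
    PresentedGroup.one_of_mem (Set.mem_range_self 2)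
  refine eq_inv_of_mul_eq_one_left (Eq.trans ?_ h)
  simp only [genZ, relator, Matrix.cons_val, mul_assoc, zpow_mul]
  rfl

theorem commute_genA_sq_genB : Commute (genA r s t u ^ (2 : ℤ)) (genB r s t u) := by
  have h := genA_conj_genB r s t u
  rw [mul_inv_eq_iff_eq_mul] at h
  have h' : genA r s t u * (genB r s t u)⁻¹ = genB r s t u * genA r s t u := by
    rw [mul_inv_eq_iff_eq_mul, mul_assoc, h, mul_inv_cancel_left]
  rw [commute_iff_eq, zpow_two, mul_assoc, h, ← mul_assoc, h', mul_assoc]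

variable {r s t u}

/-- The torus subgroup of `G` and its two Klein bottle overgroups survive in the amalgam of two
copies of the Klein bottle group along `ℤ²`; the determinant condition makes both inclusions of
`ℤ²` well defined and injective. -/
theorem exists_hom_amalgam (hdet : r * u - s * t = 1 ∨ r * u - s * t = -1) :
    ∃ (P : Type) (_ : Group P) (f₁ f₂ : Klein →* P) (F : G r s t u →* P),
      Function.Injective f₁ ∧ Function.Injective f₂ ∧ F (genB r s t u) = f₁ kleinB ∧
      F (genC r s t u) = f₂ kleinA ∧ F (genZ r s t u) = f₂ kleinB := by
  -- the inverse of the matrix of `a₂², z` in the basis `x, y` is its adjugate times `δ`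
  obtain ⟨δ, hδ, hδ0⟩ : ∃ δ : ℤ, δ * (r * u - s * t) = 1 ∧ δ * δ = 1 := by
    rcases hdet with h | h
    · exact ⟨1, by rw [h]; norm_num⟩
    · exact ⟨-1, by rw [h]; norm_num⟩
  let φ : Fin 2 → (Multiplicative (ℤ × ℤ) →* Klein) :=
    ![torusHom 1 0 0 1, torusHom (δ * u) (-(δ * s)) (-(δ * t)) (δ * r)]
  have hφ : ∀ i, Function.Injective (φ i) := by
    intro i
    fin_cases i
    · exact torusHom_injective (by norm_num)
    · refine torusHom_injective fun h => ?_
      have : δ = 0 := by linear_combination h - δ * hδ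
      simp [this] at hδ0
  let f₁ : Klein →* Monoid.PushoutI φ := Monoid.PushoutI.of (G := fun _ => Klein) 0
  let f₂ : Klein →* Monoid.PushoutI φ := Monoid.PushoutI.of (G := fun _ => Klein) 1
  have hglue : ∀ p q : ℤ, f₁ (kleinA ^ (2 * p) * kleinB ^ q) =
      f₂ (kleinA ^ (2 * (δ * (u * p - t * q))) * kleinB ^ (δ * (r * q - s * p))) := by
    intro p q
    have h1 := Monoid.PushoutI.of_apply_eq_base φ 0 (Multiplicative.ofAdd (p, q))
    have h2 := Monoid.PushoutI.of_apply_eq_base φ 1 (Multiplicative.ofAdd (p, q))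
    have e1 : kleinA ^ (2 * p) * kleinB ^ q = φ 0 (Multiplicative.ofAdd (p, q)) := by
      rw [kleinA_zpow_mul_kleinB_zpow]
      simp [φ, torusHom]
    have e2 : kleinA ^ (2 * (δ * (u * p - t * q))) * kleinB ^ (δ * (r * q - s * p)) =
        φ 1 (Multiplicative.ofAdd (p, q)) := by
      rw [kleinA_zpow_mul_kleinB_zpow]
      simp only [φ, torusHom, Matrix.cons_val_one, Matrix.cons_val_fin_one, MonoidHom.coe_mk,
        OneHom.coe_mk, toAdd_ofAdd]
      congr 3 <;> ring
    rw [e1, e2]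
    exact h1.trans h2.symm
  have hz : f₁ (kleinA ^ (2 * t) * kleinB ^ u) = f₂ kleinB := by
    rw [hglue, mul_comm u t, sub_self, hδ, mul_zero, mul_zero, zpow_zero, one_mul, zpow_one]
  have hc : f₁ (kleinA ^ (2 * r) * kleinB ^ s) = f₂ (kleinA ^ 2) := by
    rw [hglue, mul_comm u r, mul_comm t s, hδ, mul_comm s r, sub_self, mul_zero, zpow_zero,
      mul_one, mul_one]
    rfl
  let g : Fin 3 → Monoid.PushoutI φ := ![f₁ kleinA, f₁ kleinB, f₂ kleinA]
  have hg : ∀ w ∈ Set.range (relator r s t u), FreeGroup.lift g w = 1 := by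
    rintro _ ⟨i, rfl⟩
    fin_cases i
    · simp only [relator, g, Fin.zero_eta, Matrix.cons_val, map_mul, map_inv,
        FreeGroup.lift_apply_of]
      rw [← map_mul, ← map_inv, ← map_mul, kleinA_conj_kleinB, map_inv, inv_mul_cancel]
    · simp only [relator, g, Fin.mk_one, Matrix.cons_val, map_mul, map_inv, map_zpow, map_pow,
        FreeGroup.lift_apply_of]
      rw [← map_zpow, ← map_zpow, ← map_mul, hc, map_pow, mul_inv_cancel]
    · simp only [relator, g, Fin.reduceFinMk, Matrix.cons_val, map_mul, map_inv, map_zpow,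
        FreeGroup.lift_apply_of]
      rw [← map_zpow, ← map_zpow, mul_assoc, mul_assoc (f₂ kleinA), ← map_mul, hz, ← map_mul,
        ← map_inv, ← map_mul, kleinA_conj_kleinB, map_inv, inv_mul_cancel]
  refine ⟨Monoid.PushoutI φ, inferInstance, f₁, f₂, PresentedGroup.toGroup hg,
    Monoid.PushoutI.of_injective hφ 0, Monoid.PushoutI.of_injective hφ 1,
    PresentedGroup.toGroup.of hg, PresentedGroup.toGroup.of hg, ?_⟩
  rw [← hz, genZ, map_mul, map_zpow, map_zpow, map_zpow, PresentedGroup.toGroup.of,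
    PresentedGroup.toGroup.of, map_mul, map_zpow, map_zpow, zpow_mul]
  rfl

theorem genB_zpow_eq_one (hdet : r * u - s * t = 1 ∨ r * u - s * t = -1) {k : ℤ}
    (h : genB r s t u ^ k = 1) : k = 0 := by
  obtain ⟨P, _, f₁, f₂, F, h₁, -, hB, -, -⟩ := exists_hom_amalgam hdet
  refine kleinB_zpow_eq_one (h₁ ?_)
  rw [map_zpow, ← hB, ← map_zpow, h, map_one, map_one]

theorem genZ_zpow_eq_one (hdet : r * u - s * t = 1 ∨ r * u - s * t = -1) {k : ℤ}
    (h : genZ r s t u ^ k = 1) : k = 0 := by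
  obtain ⟨P, _, f₁, f₂, F, -, h₂, -, -, hZ⟩ := exists_hom_amalgam hdet
  refine kleinB_zpow_eq_one (h₂ ?_)
  rw [map_zpow, ← hZ, ← map_zpow, h, map_one, map_one]

theorem eq_zero_of_genC_zpow_mem (hdet : r * u - s * t = 1 ∨ r * u - s * t = -1) {k : ℤ}
    (h : genC r s t u ^ k ∈ Subgroup.zpowers (genZ r s t u)) : k = 0 := by
  obtain ⟨P, _, f₁, f₂, F, -, h₂, -, hC, hZ⟩ := exists_hom_amalgam hdet
  obtain ⟨l, hl⟩ := h
  have hl : genZ r s t u ^ l = genC r s t u ^ k := hl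
  refine eq_zero_of_kleinA_zpow_eq (l := l) (h₂ ?_)
  rw [map_zpow, map_zpow, ← hC, ← hZ, ← map_zpow, ← map_zpow, hl]

end Group

/-! ### The relator matrix and the equation for the coefficient of `ρ₁` -/

section Rows

variable {r s t u : ℤ}

theorem fox_zpow_of_ne {i j : Fin 3} (h : i ≠ j) (n : ℤ) :
    fox r s t u j (FreeGroup.of i ^ n) = 0 := by
  rw [fox_zpow, fox_of, if_neg h, mul_zero]

theorem mk_conj_torus : genC r s t u * genA r s t u ^ (2 * t) * genB r s t u ^ u *
    (genC r s t u)⁻¹ = genA r s t u ^ (-(2 * t)) * genB r s t u ^ (-u) := by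
  have h := genC_conj_genZ r s t u
  rw [genZ, ← mul_assoc, ((commute_genA_sq_genB r s t u).zpow_zpow t u).eq, mul_inv_rev,
    ← zpow_neg, ← zpow_neg, ← zpow_mul, ← zpow_mul] at h
  rw [h, mul_neg]

theorem d₂Rows_eq_fox (i j : Fin 3) :
    d₂Rows r s t u i j = fox r s t u j (relator r s t u i) := by
  have h1 : word r s t u (FreeGroup.of 0 * FreeGroup.of 1 * (FreeGroup.of 0)⁻¹) =
      word r s t u (FreeGroup.of 1)⁻¹ := congrArg (of ℤ _) (genA_conj_genB r s t u)
  have h2 : word r s t u (FreeGroup.of 0 ^ (2 * r) * FreeGroup.of 1 ^ s) *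
      word r s t u (FreeGroup.of 2 * FreeGroup.of 2)⁻¹ = 1 := by
    rw [← word_mul, ← pow_two]
    exact word_relator 1
  have h3 : word r s t u (FreeGroup.of 2 * FreeGroup.of 0 ^ (2 * t) * FreeGroup.of 1 ^ u *
      (FreeGroup.of 2)⁻¹) = word r s t u (FreeGroup.of 0 ^ (-(2 * t)) * FreeGroup.of 1 ^ (-u)) :=
    congrArg (of ℤ _) mk_conj_torus
  have h4 : word r s t u (FreeGroup.of 0 ^ (-(2 * t)) * FreeGroup.of 1 ^ (-u)) *
      word r s t u (FreeGroup.of 0 ^ (2 * t)) = word r s t u (FreeGroup.of 1 ^ (-u)) := by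
    rw [← word_mul]
    refine congrArg (of ℤ _) ?_
    change genA r s t u ^ (-(2 * t)) * genB r s t u ^ (-u) * genA r s t u ^ (2 * t) =
      genB r s t u ^ (-u)
    rw [mul_assoc, zpow_neg, zpow_mul, ((commute_genA_sq_genB r s t u).zpow_zpow t (-u)).symm.eq,
      inv_mul_cancel_left]
  have e10 : (1 : Fin 3) ≠ 0 := by decide
  have e20 : (2 : Fin 3) ≠ 0 := by decide
  have e01 : (0 : Fin 3) ≠ 1 := by decide
  have e21 : (2 : Fin 3) ≠ 1 := by decide
  have e02 : (0 : Fin 3) ≠ 2 := by decide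
  have e12 : (1 : Fin 3) ≠ 2 := by decide
  -- only `fox_zpow_of_ne` is applied to powers: the other derivatives of powers occur on both sides
  fin_cases i <;> fin_cases j <;>
    simp only [d₂Rows, relator, Fin.zero_eta, Fin.mk_one, Fin.reduceFinMk, Matrix.cons_val,
      fox_mul, fox_inv, fox_of, fox_zpow_of_ne e10, fox_zpow_of_ne e01, fox_zpow_of_ne e02,
      fox_zpow_of_ne e12, pow_two, if_true, if_neg e10, if_neg e20, if_neg e01, if_neg e21,
      if_neg e02, if_neg e12, mul_zero, add_zero, zero_add, mul_one, neg_zero, mul_neg]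
  · rw [← word_mul, h1, sub_eq_add_neg]
  · rw [h1]
  · rw [← mul_assoc, h2, one_mul, neg_add, add_comm, sub_eq_add_neg]
  · rw [h3]
  · rw [word_mul _ (FreeGroup.of 0 ^ (2 * t)), word_mul (_ * (FreeGroup.of 2)⁻¹), h3, h4]
  · rw [← word_mul, h3, sub_eq_add_neg]

end Rows

section Klein

variable {H : Type*} [Group H] {a b : H}

theorem geomSum_conj (hab : a * b * a⁻¹ = b⁻¹) (n : ℤ) :
    (geomSum b n + of ℤ H a * geomSum b (-n)) * of ℤ H b * (1 - of ℤ H b⁻¹) =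
      (of ℤ H (b ^ n) - 1) * (1 + of ℤ H a) := by
  have hba : a * b ^ (-n) = b ^ n * a := by
    rw [← mul_inv_eq_iff_eq_mul, ← conj_zpow, hab, inv_zpow, zpow_neg, inv_inv]
  have hb : of ℤ H b * (1 - of ℤ H b⁻¹) = of ℤ H b - 1 := by
    rw [mul_sub, mul_one, of_mul_of, mul_inv_cancel, map_one]
  rw [mul_assoc, hb, add_mul, mul_assoc, geomSum_mul_sub_one, geomSum_mul_sub_one, mul_sub,
    of_mul_of, hba, ← of_mul_of]
  noncomm_ring

/-- In the group ring of the Klein bottle group, with `x = a²` and `y = b`, the element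
`(1 - xʳ yˢ) ∂a²ᵗ/∂a - (1 - xᵗ yᵘ) ∂a²ʳ/∂a` vanishes when `y` is set to `1` on the right, so it is
a left multiple of `1 - b⁻¹`, with an explicit quotient. -/
theorem klein_quotient (hab : a * b * a⁻¹ = b⁻¹) (hcomm : Commute (a ^ (2 : ℤ)) b) (r s t u : ℤ) :
    (of ℤ H ((a ^ (2 : ℤ)) ^ t) * geomSum (a ^ (2 : ℤ)) r *
        (geomSum b u + of ℤ H a * geomSum b (-u)) -
      of ℤ H ((a ^ (2 : ℤ)) ^ r) * geomSum (a ^ (2 : ℤ)) t *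
        (geomSum b s + of ℤ H a * geomSum b (-s))) * of ℤ H b * (1 - of ℤ H b⁻¹) =
    (1 - of ℤ H ((a ^ (2 : ℤ)) ^ r * b ^ s)) * (geomSum (a ^ (2 : ℤ)) t * (1 + of ℤ H a)) -
      (1 - of ℤ H ((a ^ (2 : ℤ)) ^ t * b ^ u)) * (geomSum (a ^ (2 : ℤ)) r * (1 + of ℤ H a)) := by
  set x := a ^ (2 : ℤ)
  have hsym : (of ℤ H (x ^ r) - 1) * geomSum x t = (of ℤ H (x ^ t) - 1) * geomSum x r := by
    have h1 : Commute (geomSum x r) (geomSum x t) :=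
      (Commute.sum_right _ _ _ fun _ _ => geomSum_commute ((Commute.refl x).zpow_right _) r).sub_right
        (Commute.sum_right _ _ _ fun _ _ => geomSum_commute ((Commute.refl x).zpow_right _) r)
    have h2 : ∀ n : ℤ, (of ℤ H x - 1) * geomSum x n = geomSum x n * (of ℤ H x - 1) := fun n =>
      ((geomSum_commute (Commute.refl x) n).sub_right (Commute.one_right _)).eq.symm
    rw [← geomSum_mul_sub_one x r, ← geomSum_mul_sub_one x t, mul_assoc, mul_assoc, h2, h2,
      ← mul_assoc, ← mul_assoc, h1.eq]
  have hs := (geomSum_commute (hcomm.zpow_right s) t).eq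
  have hu := (geomSum_commute (hcomm.zpow_right u) r).eq
  rw [sub_mul, sub_mul, mul_assoc _ (of ℤ H b), mul_assoc _ (of ℤ H b), mul_assoc _ _ (of ℤ H b * _),
    mul_assoc _ _ (of ℤ H b * _), ← mul_assoc _ (of ℤ H b), ← mul_assoc _ (of ℤ H b),
    geomSum_conj hab, geomSum_conj hab, ← mul_assoc, ← mul_assoc, ← mul_assoc, ← mul_assoc,
    ← sub_mul, ← sub_mul]
  congr 1
  rw [← of_mul_of, ← of_mul_of, sub_mul 1, sub_mul 1, mul_assoc _ (of ℤ H (b ^ s)), ← hs,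
    mul_assoc _ (of ℤ H (b ^ u)), ← hu, mul_sub, mul_sub, mul_assoc _ _ (of ℤ H (b ^ s)),
    mul_assoc _ _ (of ℤ H (b ^ u))]
  simp only [sub_mul, one_mul] at hsym ⊢
  simp only [mul_one]
  rw [sub_eq_sub_iff_add_eq_add] at hsym ⊢
  have := sub_eq_zero.2 hsym
  rw [← sub_eq_zero, ← this]
  abel

end Klein

/-! ### Exactness at `F₂` and `F₃` -/

section Exactness

variable {r s t u : ℤ}

theorem Y₀_eq : Y₀ r s t u = 1 - of ℤ _ (genZ r s t u) := by
  simp only [Y₀, word, map_mul, map_zpow, map_pow, genZ]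
  rfl

theorem Z₀_eq : Z₀ r s t u = of ℤ _ (genC r s t u) - of ℤ _ (genZ r s t u) := by
  simp only [Z₀, word, map_mul, map_zpow, map_pow, genZ]
  rfl

theorem word_genZ_inv : word r s t u (FreeGroup.of 0 ^ (-(2 * t)) * FreeGroup.of 1 ^ (-u)) =
    of ℤ _ (genZ r s t u)⁻¹ := by
  refine congrArg (of ℤ _) ?_
  change genA r s t u ^ (-(2 * t)) * genB r s t u ^ (-u) = _
  rw [genZ, mul_inv_rev, ← zpow_neg, ← zpow_neg,
    ((commute_genA_sq_genB r s t u).zpow_zpow (-t) (-u)).symm.eq, ← zpow_mul, mul_neg]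

theorem genC_mul_genZ_inv : of ℤ _ (genC r s t u) * of ℤ _ (genZ r s t u)⁻¹ =
    of ℤ _ (genZ r s t u) * of ℤ _ (genC r s t u) := by
  rw [of_mul_of, of_mul_of]
  congr 1
  rw [mul_inv_eq_iff_eq_mul, mul_assoc, ← inv_mul_eq_iff_eq_mul,
    ← genC_conj_genZ, inv_mul_cancel_right]

theorem genZ_mul_genZ_inv :
    of ℤ _ (genZ r s t u) * of ℤ _ (genZ r s t u)⁻¹ = 1 := by
  rw [of_mul_of, mul_inv_cancel, map_one]

theorem Z₀_mul_one_sub : Z₀ r s t u * (1 - of ℤ _ (genZ r s t u)⁻¹) =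
    Y₀ r s t u * (of ℤ _ (genC r s t u) + 1) := by
  rw [Z₀_eq, Y₀_eq, mul_sub, sub_mul _ _ (of ℤ _ (genZ r s t u)⁻¹), genC_mul_genZ_inv,
    genZ_mul_genZ_inv]
  noncomm_ring

theorem Z₀_mul_add : Z₀ r s t u * (of ℤ _ (genC r s t u) + of ℤ _ (genZ r s t u)⁻¹) =
    of ℤ _ ((genA r s t u ^ (2 : ℤ)) ^ r * genB r s t u ^ s) - 1 := by
  rw [Z₀_eq, ← genC_sq, mul_add, sub_mul _ _ (of ℤ _ (genZ r s t u)⁻¹), genC_mul_genZ_inv,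
    genZ_mul_genZ_inv, sub_mul, of_mul_of _ (genC r s t u), ← pow_two]
  abel

theorem d₂_apply_zero (v : Fin 3 → ZG r s t u) : d₂ r s t u v 0 =
    v 0 * (1 - of ℤ _ (genB r s t u)⁻¹) + v 1 * d₂Rows r s t u 1 0 + v 2 * d₂Rows r s t u 2 0 := by
  rw [d₂_apply, Fin.sum_univ_three]
  rfl

theorem d₂_apply_two (v : Fin 3 → ZG r s t u) : d₂ r s t u v 2 =
    v 2 * (1 - of ℤ _ (genZ r s t u)⁻¹) - v 1 * (of ℤ _ (genC r s t u) + 1) := by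
  rw [d₂_apply, Fin.sum_univ_three, show d₂Rows r s t u 0 2 = 0 from rfl,
    show d₂Rows r s t u 1 2 = -of ℤ _ (genC r s t u) - 1 from rfl, ← word_genZ_inv,
    show d₂Rows r s t u 2 2 =
      1 - word r s t u (FreeGroup.of 0 ^ (-(2 * t)) * FreeGroup.of 1 ^ (-u)) from rfl]
  noncomm_ring

theorem d₃_apply (X c : ZG r s t u) :
    d₃ r s t u X c = ![c * X, c * Y₀ r s t u, c * Z₀ r s t u] := by
  ext i : 1
  fin_cases i <;> simp [d₃]

/-- Vanishing of the `α₁`-coordinate of `d₂(d₃(1))`, as an equation for the coefficient of `ρ₁`. -/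
def IsCoefficient (r s t u : ℤ) (X : ZG r s t u) : Prop :=
  X * (1 - of ℤ _ (genB r s t u)⁻¹) + Y₀ r s t u * d₂Rows r s t u 1 0 +
    Z₀ r s t u * d₂Rows r s t u 2 0 = 0

theorem IsResolution.isCoefficient {X : ZG r s t u} (h : IsResolution r s t u X) :
    IsCoefficient r s t u X := by
  have h1 := congrFun (h.2.1.apply_apply_eq_zero 1) 0
  rw [d₂_apply_zero, d₃_apply] at h1
  simpa [IsCoefficient] using h1

theorem eq_zero_of_mul_one_sub_genB_inv (hdet : r * u - s * t = 1 ∨ r * u - s * t = -1)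
    {c : ZG r s t u} (h : c * (1 - of ℤ _ (genB r s t u)⁻¹) = 0) : c = 0 :=
  eq_zero_of_mul_one_sub_of
    (fun k hk => genB_zpow_eq_one hdet (by rwa [inv_zpow, inv_eq_one] at hk)) h

theorem IsCoefficient.unique (hdet : r * u - s * t = 1 ∨ r * u - s * t = -1) {X X' : ZG r s t u}
    (h : IsCoefficient r s t u X) (h' : IsCoefficient r s t u X') : X = X' := by
  refine sub_eq_zero.1 (eq_zero_of_mul_one_sub_genB_inv hdet ?_)
  rw [sub_mul, sub_eq_zero]
  rw [IsCoefficient, add_assoc] at h h'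
  exact add_right_cancel (h.trans h'.symm)

/-- The `α₁`-coordinate of `d₂(d₃(1))` vanishes by assumption and the `α₂`-coordinate by the
relations; the `β₁`-coordinate then vanishes because `d₁ ∘ d₂ = 0` and `b₁ - 1` is not a right zero
divisor. -/
theorem IsCoefficient.d₂_d₃_one (hdet : r * u - s * t = 1 ∨ r * u - s * t = -1) {X : ZG r s t u}
    (h : IsCoefficient r s t u X) : d₂ r s t u (d₃ r s t u X 1) = 0 := by
  have h0 : d₂ r s t u (d₃ r s t u X 1) 0 = 0 := by
    rw [d₂_apply_zero, d₃_apply]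
    simpa [IsCoefficient] using h
  have h2 : d₂ r s t u (d₃ r s t u X 1) 2 = 0 := by
    rw [d₂_apply_two, d₃_apply]
    simp only [Matrix.cons_val, one_mul]
    rw [Z₀_mul_one_sub, sub_self]
  have h1 : d₂ r s t u (d₃ r s t u X 1) 1 = 0 := by
    have h := d₁_comp_d₂ (r := r) (s := s) (t := t) (u := u) d₂Rows_eq_fox (d₃ r s t u X 1)
    rw [d₁_apply, Fin.sum_univ_three, h0, h2, zero_mul, zero_mul, zero_add, add_zero] at h
    refine eq_zero_of_mul_one_sub_of (g := genB r s t u) (fun k hk => genB_zpow_eq_one hdet hk) ?_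
    rw [← neg_sub, mul_neg, neg_eq_zero]
    exact h
  funext i
  fin_cases i
  · exact h0
  · exact h1
  · exact h2

theorem injective_d₃ (hdet : r * u - s * t = 1 ∨ r * u - s * t = -1)
    (X : ZG r s t u) : Function.Injective (d₃ r s t u X) := by
  rw [← LinearMap.ker_eq_bot, LinearMap.ker_eq_bot']
  intro c hc
  have h1 := congrFun hc 1
  rw [d₃_apply, Y₀_eq] at h1
  exact eq_zero_of_mul_one_sub_of (fun k hk => genZ_zpow_eq_one hdet hk) h1

/-- A cycle has its `ρ₂`- and `ρ₃`-coefficients divisible on the right by `Y₀` and `Z₀` with a common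
quotient, by the `α₂`-coordinate; its `ρ₁`-coefficient is then determined by the
`α₁`-coordinate. -/
theorem IsCoefficient.exact_d₃_d₂ (hdet : r * u - s * t = 1 ∨ r * u - s * t = -1)
    {X : ZG r s t u} (h : IsCoefficient r s t u X) :
    Function.Exact (d₃ r s t u X) (d₂ r s t u) := by
  intro v
  constructor
  · intro hv
    have h2 := congrFun hv 2
    rw [d₂_apply_two, Pi.zero_apply, sub_eq_zero] at h2
    obtain ⟨w', hw'⟩ := exists_eq_of_mul_add_one (z := (genZ r s t u)⁻¹) (c := genC r s t u)
      (by rw [← conj_inv, genC_conj_genZ])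
      (fun k hk => eq_zero_of_genC_zpow_mem hdet (by rwa [Subgroup.zpowers_inv] at hk)) h2.symm
    obtain ⟨w, hw⟩ : ∃ w, v 1 = w * Y₀ r s t u := by
      refine ⟨-(w' * of ℤ _ (genZ r s t u)⁻¹), ?_⟩
      rw [hw', Y₀_eq, neg_mul, mul_assoc, mul_sub _ _ (of ℤ _ (genZ r s t u)), of_mul_of,
        inv_mul_cancel, map_one]
      noncomm_ring
    have hv2 : v 2 = w * Z₀ r s t u := by
      refine sub_eq_zero.1 (eq_zero_of_mul_one_sub_of (g := (genZ r s t u)⁻¹)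
        (fun k hk => genZ_zpow_eq_one hdet (by rwa [inv_zpow, inv_eq_one] at hk)) ?_)
      rw [sub_mul, h2, hw, mul_assoc, mul_assoc, Z₀_mul_one_sub, sub_self]
    have hv0 : v 0 = w * X := by
      refine sub_eq_zero.1 (eq_zero_of_mul_one_sub_genB_inv hdet ?_)
      have h0 := congrFun hv 0
      have h3 := congrArg (w * ·) h
      simp only [mul_add, mul_zero, ← mul_assoc] at h3
      rw [d₂_apply_zero, hw, hv2, Pi.zero_apply, ← h3, add_assoc, add_assoc] at h0
      rw [sub_mul, sub_eq_zero]
      exact add_right_cancel h0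
    refine ⟨w, ?_⟩
    rw [d₃_apply, ← hv0, ← hw, ← hv2]
    ext i : 1
    fin_cases i <;> rfl
  · rintro ⟨c, rfl⟩
    rw [← mul_one c, ← smul_eq_mul, map_smul, map_smul, h.d₂_d₃_one hdet, smul_zero]

theorem IsCoefficient.isResolution (hdet : r * u - s * t = 1 ∨ r * u - s * t = -1)
    {X : ZG r s t u} (h : IsCoefficient r s t u X) : IsResolution r s t u X :=
  ⟨injective_d₃ hdet X, h.exact_d₃_d₂ hdet, exact_d₂_d₁ d₂Rows_eq_fox,
    exact_d₁_augmentation, augmentation_surjective⟩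

end Exactness

/-! ### The coefficient of `ρ₁` -/

section Coefficient

variable {r s t u : ℤ}

/-- The coefficient of `ρ₁` for arbitrary signs of `r` and `t`. -/
noncomputable def coefficient (r s t u : ℤ) : ZG r s t u :=
  (of ℤ _ ((genA r s t u ^ (2 : ℤ)) ^ t) * geomSum (genA r s t u ^ (2 : ℤ)) r *
      (geomSum (genB r s t u) u + of ℤ _ (genA r s t u) * geomSum (genB r s t u) (-u)) -
    of ℤ _ ((genA r s t u ^ (2 : ℤ)) ^ r) * geomSum (genA r s t u ^ (2 : ℤ)) t *
      (geomSum (genB r s t u) s + of ℤ _ (genA r s t u) * geomSum (genB r s t u) (-s))) *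
    of ℤ _ (genB r s t u)

theorem fox_even_zpow (n : ℤ) : fox r s t u 0 (FreeGroup.of 0 ^ (2 * n)) =
    geomSum (genA r s t u ^ (2 : ℤ)) n * (1 + of ℤ _ (genA r s t u)) := by
  rw [zpow_mul, fox_zpow, zpow_two, fox_mul, fox_of, if_pos rfl, mul_one, zpow_two]
  rfl

theorem fox_genB_zpow (n : ℤ) :
    fox r s t u 1 (FreeGroup.of 1 ^ n) = geomSum (genB r s t u) n := by
  rw [fox_zpow, fox_of, if_pos rfl, mul_one]
  rfl

theorem isCoefficient_coefficient : IsCoefficient r s t u (coefficient r s t u) := by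
  have h1 : d₂Rows r s t u 1 0 =
      geomSum (genA r s t u ^ (2 : ℤ)) r * (1 + of ℤ _ (genA r s t u)) := fox_even_zpow r
  have h2 : d₂Rows r s t u 2 0 = (of ℤ _ (genC r s t u) + of ℤ _ (genZ r s t u)⁻¹) *
      (geomSum (genA r s t u ^ (2 : ℤ)) t * (1 + of ℤ _ (genA r s t u))) := by
    rw [← fox_even_zpow, ← word_genZ_inv, add_mul]
    rfl
  rw [IsCoefficient, h1, h2, ← mul_assoc (Z₀ r s t u), Z₀_mul_add, coefficient,
    klein_quotient (genA_conj_genB r s t u) (commute_genA_sq_genB r s t u), Y₀_eq]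
  noncomm_ring

theorem sum_word_even (m n : ℤ) :
    ∑ k ∈ Finset.Icc m (n - 1), word r s t u (FreeGroup.of 0 ^ (2 * k)) =
    ∑ k ∈ Finset.Ico m n, of ℤ _ ((genA r s t u ^ (2 : ℤ)) ^ k) := by
  refine Finset.sum_congr (by ext; simp) fun k _ => ?_
  rw [← zpow_mul]
  rfl

theorem sum_word_odd (m n : ℤ) :
    ∑ k ∈ Finset.Icc (m + 1) n, word r s t u (FreeGroup.of 0 ^ (2 * k - 1)) =
    (∑ k ∈ Finset.Ico m n, of ℤ _ ((genA r s t u ^ (2 : ℤ)) ^ k)) * of ℤ _ (genA r s t u) := by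
  rw [Finset.sum_mul]
  refine Finset.sum_nbij' (· - 1) (· + 1) ?_ ?_ (by simp) (by simp) fun k _ => ?_
  · intro k hk
    simp only [Finset.mem_Icc, Finset.mem_Ico] at hk ⊢
    omega
  · intro k hk
    simp only [Finset.mem_Icc, Finset.mem_Ico] at hk ⊢
    omega
  · rw [of_mul_of, ← zpow_mul, ← zpow_add_one, show 2 * (k - 1) + 1 = 2 * k - 1 by ring]
    rfl

theorem X₀_eq_coefficient (hr : 0 < r) (ht : t < 0) : X₀ r s t u = coefficient r s t u := by
  simp only [X₀, coefficient, fox_genB_zpow, ← Finset.sum_mul, sum_word_even, sum_word_odd,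
    of_zpow_mul_geomSum]
  rw [Finset.Ico_eq_empty_of_le (by omega : t ≤ t + r),
    Finset.Ico_eq_empty_of_le (by omega : r + t ≤ r), Finset.sum_empty, sub_zero, zero_sub,
    add_comm t r, show word r s t u (FreeGroup.of 1) = of ℤ _ (genB r s t u) from rfl]
  noncomm_ring

end Coefficient

end Sapphire

theorem mainTheorem1 (r s t u : ℤ)
    (hdet : r * u - s * t = 1 ∨ r * u - s * t = -1) (hne : r * s * t * u ≠ 0) :
    (∀ i j : Fin 3, Sapphire.d₂Rows r s t u i j =
      Sapphire.fox r s t u j (Sapphire.relator r s t u i)) ∧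
    (∃! X : Sapphire.ZG r s t u, Sapphire.IsResolution r s t u X) ∧
    (0 < r → t < 0 → Sapphire.IsResolution r s t u (Sapphire.X₀ r s t u)) := by
  have hcoeff := Sapphire.isCoefficient_coefficient (r := r) (s := s) (t := t) (u := u)
  refine ⟨Sapphire.d₂Rows_eq_fox, ⟨_, hcoeff.isResolution hdet, fun X hX => ?_⟩, fun hr ht => ?_⟩
  · exact hX.isCoefficient.unique hdet hcoeff
  · rw [Sapphire.X₀_eq_coefficient hr ht]
    exact hcoeff.isResolution hdet
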